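/- Let $d \ge 2$ and consider the infinite rooted $d$-ary tree (the root has $d$ neighbors, every other vertex has a parent and $d$ children). In the frog model with i.i.d.-$\pi$ initial conditions, the root initially contains one active particle, and the other vertices $v$ contain independent numbers $\eta(v)$ of sleeping particles, each with distribution $\pi$. Active particles perform independent discrete-time simple random walks on the tree, independent of $\eta$; when an active particle visits a vertex, all sleeping particles there become active. The model is transient if the root is not visited infinitely often by particles. Then for every $\mu > 0$ there is $N_0 = N_0(d,\mu)$ such that for every integer $N \ge N_0$, $$\pi_N = \frac{\mu}{N}\,\delta_N + \Bigl(1-\frac{\mu}{N}\Bigr)\delta_0$$ is a probability distribution on $\{0,1,2,\dots\}$ with mean $\mu$, and the frog model on the $d$-ary tree with i.i.d.-$\pi_N$ initial conditions is almost surely transient. In particular, for arbitrarily large $\mu$ there is a distribution $\pi$ with mean $\mu$ for which the model is almost surely transient. -/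

import Mathlib

open MeasureTheory ProbabilityTheory
open scoped ENNReal

noncomputable section

namespace FrogModel

/-! ### Simple random walk on a locally finite graph -/

section Walk

variable {V : Type*} (G : SimpleGraph V) [G.LocallyFinite]

open Classical in
/-- The law of one step of simple random walk from `v`: uniform on the neighbours of `v`.
(By convention the walk stays put at an isolated vertex.) -/
def step (v : V) : PMF V :=
  if h : (G.neighborFinset v).Nonempty then PMF.uniformOfFinset (G.neighborFinset v) h
  else PMF.pure v

variable [Countable V] [MeasurableSpace V] [DiscreteMeasurableSpace V]

/-- The transition kernel of simple random walk. -/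
def stepKernel : Kernel V V := Kernel.ofFunOfCountable fun v => (step G v).toMeasure

instance : IsMarkovKernel (stepKernel G) :=
  ⟨fun v => by
    change IsProbabilityMeasure (step G v).toMeasure
    infer_instance⟩

/-- Given the path up to time `n`, the next position is one step from the position at time `n`. -/
def pathKernel (n : ℕ) : Kernel ((i : Finset.Iic n) → V) V :=
  (stepKernel G).comap (fun h => h ⟨n, Finset.mem_Iic.2 le_rfl⟩) (measurable_pi_apply _)

instance (n : ℕ) : IsMarkovKernel (pathKernel G n) := by
  unfold pathKernel
  infer_instance

/-- The law on paths `ℕ → V` of discrete-time simple random walk started at `v`. -/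
def walkLaw (v : V) : Measure (ℕ → V) :=
  Kernel.trajMeasure (X := fun _ => V) (Measure.dirac v) (pathKernel G)

end Walk

/-! ### The frog model -/

/-- A realization `(η, S)` of the random inputs: for every vertex `v`, the number
`(ω v).1 = η v` of sleeping particles at `v`, and the paths `(ω v).2 i = S (v, i)`, where
`S (v, i) n` is the position of particle `i` of `v` after `n` steps from its activation.
Particles at `v` are numbered from `0`, and only the paths with `i < η v` are used. -/
abbrev Realization (V : Type*) := V → ℕ × (ℕ → ℕ → V)

section Dynamics

variable {V : Type*} (root : V) (ω : Realization V)

open Classical in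
/-- The number of particles starting at `v`: one at the root (active from time `0`),
and `η v` (sleeping) at any other vertex. -/
def numParticles (v : V) : ℕ := if v = root then 1 else (ω v).1

open Classical in
/-- `wakeTime root ω t v` is `some s` if the particles of `v` have been activated by time `t`,
the activation having taken place at time `s ≤ t`, and `none` if they are still asleep at time `t`.
The particle of the root is active from time `0`; the particles at any other vertex are activated
as soon as an active particle visits that vertex. -/
def wakeTime : ℕ → V → Option ℕ
  | 0, v => if v = root then some 0 else none
  | t + 1, v =>
    match wakeTime t v with
    | some s => some s
    | none =>
      if ∃ (u : V) (i s : ℕ), wakeTime t u = some s ∧ i < numParticles root ω u ∧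
          (ω u).2 i (t + 1 - s) = v
      then some (t + 1) else none

/-- At time `t`, particle `i` of vertex `u` is active and located at `v`. -/
def ActiveAt (t : ℕ) (u : V) (i : ℕ) (v : V) : Prop :=
  ∃ s, wakeTime root ω t u = some s ∧ i < numParticles root ω u ∧ (ω u).2 i (t - s) = v

/-- The realization is recurrent if the root is visited infinitely often by particles: there are
infinitely many pairs of a time and a particle that is active and at the root at that time. -/
def Recurrent : Prop :=
  {p : ℕ × V × ℕ | ActiveAt root ω p.1 p.2.1 p.2.2 root}.Infinite

/-- The realization is transient if it is not recurrent. -/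
def Transient : Prop := ¬ Recurrent root ω

end Dynamics

/-- The law of the random inputs of the frog model on `G` with i.i.d.-`π` initial conditions:
all counts `η v` have law `π`, all paths `S (v, i)` are simple random walks started at `v`,
and all these are independent. -/
def law {V : Type*} (G : SimpleGraph V) [G.LocallyFinite] [Countable V] [MeasurableSpace V]
    [DiscreteMeasurableSpace V] (π : ProbabilityMeasure ℕ) : Measure (Realization V) :=
  Measure.infinitePi fun v =>
    (π : Measure ℕ).prod (Measure.infinitePi fun _ : ℕ => walkLaw G v)

/-! ### The `d`-ary tree -/

/-- Vertices of the infinite `d`-ary tree: finite words over `d` letters. The root is the empty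
word, and the `d` children of `v` are the words `i :: v`. -/
def TreeVertex (d : ℕ) : Type := List (Fin d)

/-- The root of the `d`-ary tree. -/
def treeRoot (d : ℕ) : TreeVertex d := ([] : List (Fin d))

/-- The `i`-th child of a vertex of the `d`-ary tree. -/
def child {d : ℕ} (i : Fin d) (v : TreeVertex d) : TreeVertex d := List.cons i v

instance (d : ℕ) : Countable (TreeVertex d) := inferInstanceAs (Countable (List (Fin d)))

instance (d : ℕ) : MeasurableSpace (TreeVertex d) := ⊤

instance (d : ℕ) : DiscreteMeasurableSpace (TreeVertex d) := ⟨fun _ => trivial⟩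

/-- The infinite `d`-ary tree: every vertex is joined to each of its `d` children. -/
def daryTree (d : ℕ) : SimpleGraph (TreeVertex d) where
  Adj u v := (∃ i, v = child i u) ∨ (∃ i, u = child i v)
  symm := ⟨fun _ _ h => h.symm⟩
  loopless := ⟨by
    rintro v (⟨i, h⟩ | ⟨i, h⟩) <;> exact List.cons_ne_self i v h.symm⟩

theorem neighborSet_finite (d : ℕ) (v : TreeVertex d) : ((daryTree d).neighborSet v).Finite := by
  have h : (daryTree d).neighborSet v ⊆
      Set.range (fun i : Fin d => child i v) ∪ {(List.tail v : List (Fin d))} := by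
    rintro u (⟨i, rfl⟩ | ⟨i, rfl⟩)
    · exact Or.inl ⟨i, rfl⟩
    · exact Or.inr rfl
  exact ((Set.finite_range _).union (Set.finite_singleton _)).subset h

instance (d : ℕ) : (daryTree d).LocallyFinite := fun v => (neighborSet_finite d v).fintype

end FrogModel

end

/-!
The proof is a first-moment computation. Give a vertex `v` of the tree the weight
`w v = d ^ (-|v| / 2)`. One step of simple random walk multiplies the expected weight by at most
`ρ = 2√d / (d + 1) < 1` (`lintegral_weight_le`), so after `n` steps it has shrunk by `ρ ^ n`.

Suppose that a vertex `u ≠ root` holds `N` particles and is woken up. The probability that one of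
them is at `v` at time `n` is at most `N` times the `n`-step transition probability, and also at
most `(d + 1) ^ n` times it, since this product is at least `1` whenever the transition probability
is positive. Hence the vertices visited by the particles of `u` have mean total weight at most
`w u * ∑ n, min ((d + 1) ^ n) N * ρ ^ n` (`tsum_pathsLaw_visits_mul_le`). As a vertex holds
particles with probability `μ / N` only, the mean total weight of the occupied vertices that an
occupied vertex activates is at most
`r = ∑ n, μ / N * (min ((d + 1) ^ n) N * ρ ^ n)` times its own weight, and `r → 0` as `N → ∞` by
dominated convergence (`tendsto_branching_rate`).

If `r < 1`, compare with a branching process. A vertex that ever wakes up is the end of a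
self-avoiding chain of vertices starting at the root, each visited by a particle of its predecessor
(`exists_le_chainSum`). The links of such a chain are independent because its vertices are distinct
(`lintegral_chainSum_succ`), so the chains with `k + 1` links have mean total weight
`O(r ^ k)` (`tsum_lintegral_chainSum_le`). The particles of an awake vertex `v` visit the root
`O(w v)` times on average, so the expected number of visits to the root is finite
(`ae_transient`).
-/

namespace FrogModel

noncomputable section

/-! ### Simple random walk -/

section Walk

variable {V : Type*} (G : SimpleGraph V) [G.LocallyFinite]
variable [Countable V] [MeasurableSpace V] [DiscreteMeasurableSpace V]

instance (v : V) : IsProbabilityMeasure (walkLaw G v) := by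
  unfold walkLaw; infer_instance

theorem lintegral_walkLaw_zero (v : V) (f : V → ℝ≥0∞) :
    ∫⁻ x, f (x 0) ∂walkLaw G v = f v := by
  have hf : Measurable f := .of_discrete
  have hm : Measurable fun x : ℕ → V => f (x 0) := hf.comp (measurable_pi_apply 0)
  have hm' : Measurable fun x : (i : Finset.Iic 0) → V => f (x ⟨0, by simp⟩) :=
    hf.comp (measurable_pi_apply _)
  rw [walkLaw, Kernel.trajMeasure, Measure.lintegral_bind (by fun_prop) hm.aemeasurable,
    lintegral_map (by fun_prop) (by fun_prop), lintegral_dirac' _ (by fun_prop)]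
  have h := Kernel.traj_map_frestrictLe_apply (X := fun _ => V) (κ := pathKernel G) 0 0
    ((MeasurableEquiv.piUnique fun _ : Finset.Iic 0 => V).symm v)
  rw [Kernel.partialTraj_self, Kernel.id_apply] at h
  have h' := congrArg (fun m => ∫⁻ x, f (x ⟨0, by simp⟩) ∂m) h
  rw [lintegral_map hm' (by fun_prop), lintegral_dirac' _ hm'] at h'
  exact h'

theorem lintegral_walkLaw_succ (v : V) (n : ℕ) (f : V → ℝ≥0∞) :
    ∫⁻ x, f (x (n + 1)) ∂walkLaw G v =
      ∫⁻ x, ∫⁻ y, f y ∂stepKernel G (x n) ∂walkLaw G v := by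
  have hf : Measurable f := .of_discrete
  have key := Kernel.map_frestrictLe_trajMeasure_compProd_eq_map_trajMeasure
    (X := fun _ => V) (μ₀ := Measure.dirac v) (κ := pathKernel G) (a := n)
  have h := congrArg (fun m => ∫⁻ z, f z.2 ∂m) key
  rw [Measure.lintegral_compProd (by fun_prop), lintegral_map (by fun_prop) (by fun_prop),
    lintegral_map (by fun_prop) (by fun_prop)] at h
  exact h.symm

/-- A function `w` that contracts by `ρ` under one step of the walk contracts by `ρ ^ n`
under `n` steps. -/
theorem lintegral_walkLaw_le {w : V → ℝ≥0∞} {ρ : ℝ≥0∞}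
    (hw : ∀ v, ∫⁻ y, w y ∂stepKernel G v ≤ ρ * w v) (v : V) (n : ℕ) :
    ∫⁻ x, w (x n) ∂walkLaw G v ≤ ρ ^ n * w v := by
  induction n with
  | zero => simp [lintegral_walkLaw_zero]
  | succ n ih =>
    rw [lintegral_walkLaw_succ]
    calc _ ≤ ∫⁻ x, ρ * w (x n) ∂walkLaw G v := lintegral_mono fun x => hw _
      _ = ρ * ∫⁻ x, w (x n) ∂walkLaw G v :=
        lintegral_const_mul _ (Measurable.of_discrete.comp (measurable_pi_apply n))
      _ ≤ ρ * (ρ ^ n * w v) := by gcongr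
      _ = _ := by ring

/-- The probability that simple random walk from `u` is at `v` after `n` steps. -/
def heatKernel (n : ℕ) (u v : V) : ℝ≥0∞ := walkLaw G u {x | x n = v}

theorem measurableSet_eval_eq (n : ℕ) (v : V) : MeasurableSet {x : ℕ → V | x n = v} :=
  (measurable_pi_apply (X := fun _ : ℕ => V) n) (MeasurableSet.singleton v)

theorem lintegral_walkLaw_eq_tsum (n : ℕ) (u : V) (f : V → ℝ≥0∞) :
    ∫⁻ x, f (x n) ∂walkLaw G u = ∑' v, heatKernel G n u v * f v := by
  have hf : Measurable f := .of_discrete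
  rw [← lintegral_map (f := f) (g := fun x : ℕ → V => x n) hf (by fun_prop),
    lintegral_countable']
  refine tsum_congr fun v => ?_
  rw [Measure.map_apply (by fun_prop) (.singleton v), mul_comm]
  rfl

theorem heatKernel_succ (n : ℕ) (u v : V) :
    heatKernel G (n + 1) u v = ∑' x, heatKernel G n u x * stepKernel G x {v} := by
  have h := lintegral_walkLaw_succ G u n (({v} : Set V).indicator 1)
  rw [← lintegral_walkLaw_eq_tsum]
  simp only [lintegral_indicator_one (MeasurableSet.singleton v)] at h
  rw [← h, heatKernel, ← lintegral_indicator_one (measurableSet_eval_eq _ v)]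
  rfl

/-- If all positive one-step probabilities are at least `c`, then all positive `n`-step
probabilities are at least `c ^ n`. -/
theorem pow_le_heatKernel {c : ℝ≥0∞}
    (hc : ∀ u v, stepKernel G u {v} ≠ 0 → c ≤ stepKernel G u {v}) (n : ℕ) (u v : V)
    (h : heatKernel G n u v ≠ 0) : c ^ n ≤ heatKernel G n u v := by
  induction n generalizing v with
  | zero =>
    have h0 := lintegral_walkLaw_zero G u (({v} : Set V).indicator 1)
    have h1 : heatKernel G 0 u v = ({v} : Set V).indicator 1 u := by
      rw [← h0, heatKernel, ← lintegral_indicator_one (measurableSet_eval_eq _ v)]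
      rfl
    rw [h1] at h ⊢
    rw [Set.indicator_of_mem (Set.mem_of_indicator_ne_zero h)]
    simp
  | succ n ih =>
    rw [heatKernel_succ] at h ⊢
    obtain ⟨x, hx⟩ : ∃ x, heatKernel G n u x * stepKernel G x {v} ≠ 0 := by
      by_contra! hx
      exact h (by simp [hx])
    calc c ^ (n + 1) = c ^ n * c := pow_succ _ _
      _ ≤ heatKernel G n u x * stepKernel G x {v} :=
        mul_le_mul' (ih x (left_ne_zero_of_mul hx)) (hc x v (right_ne_zero_of_mul hx))
      _ ≤ _ := ENNReal.le_tsum x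

theorem tsum_heatKernel_mul_le {w : V → ℝ≥0∞} {ρ : ℝ≥0∞}
    (hw : ∀ v, ∫⁻ y, w y ∂stepKernel G v ≤ ρ * w v) (n : ℕ) (u : V) :
    ∑' v, heatKernel G n u v * w v ≤ ρ ^ n * w u := by
  rw [← lintegral_walkLaw_eq_tsum]
  exact lintegral_walkLaw_le G hw u n

end Walk

/-! ### Simple random walk on the tree -/

section Tree

variable {d : ℕ}

/-- The distance of a vertex from the root. -/
def depth (v : TreeVertex d) : ℕ := List.length v

@[simp] theorem depth_root : depth (treeRoot d) = 0 := rfl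

@[simp] theorem depth_child (i : Fin d) (v : TreeVertex d) : depth (child i v) = depth v + 1 := rfl

theorem eq_root_or_exists_eq_child (v : TreeVertex d) :
    v = treeRoot d ∨ ∃ i u, v = child i u :=
  match v with
  | [] => .inl rfl
  | i :: u => .inr ⟨i, u, rfl⟩

theorem child_inj {i j : Fin d} {u v : TreeVertex d} : child i u = child j v ↔ i = j ∧ u = v :=
  List.cons_eq_cons

theorem child_injective (v : TreeVertex d) : Function.Injective fun i => child i v :=
  fun _ _ h => (child_inj.1 h).1

theorem child_ne_root (i : Fin d) (v : TreeVertex d) : child i v ≠ treeRoot d :=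
  List.cons_ne_nil i v

theorem daryTree_adj {u v : TreeVertex d} :
    (daryTree d).Adj u v ↔ (∃ i, v = child i u) ∨ ∃ i, u = child i v := Iff.rfl

theorem neighborFinset_root [DecidableEq (TreeVertex d)] :
    (daryTree d).neighborFinset (treeRoot d) = Finset.univ.image fun i => child i (treeRoot d) := by
  ext u
  simp [daryTree_adj, (child_ne_root _ _).symm, eq_comm]

theorem neighborFinset_child [DecidableEq (TreeVertex d)] (i : Fin d) (v : TreeVertex d) :
    (daryTree d).neighborFinset (child i v) =
      insert v (Finset.univ.image fun j => child j (child i v)) := by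
  ext u
  simp only [SimpleGraph.mem_neighborFinset, daryTree_adj, Finset.mem_insert, Finset.mem_image,
    Finset.mem_univ, true_and, child_inj]
  constructor
  · rintro (⟨j, rfl⟩ | ⟨j, -, rfl⟩)
    · exact Or.inr ⟨j, rfl⟩
    · exact Or.inl rfl
  · rintro (rfl | ⟨j, rfl⟩)
    · exact Or.inr ⟨i, rfl, rfl⟩
    · exact Or.inl ⟨j, rfl⟩

theorem notMem_image_child [DecidableEq (TreeVertex d)] (i : Fin d) (v : TreeVertex d) :
    v ∉ Finset.univ.image fun j => child j (child i v) := by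
  intro h
  obtain ⟨j, -, hj⟩ := Finset.mem_image.1 h
  have := congrArg depth hj
  simp only [depth_child] at this
  omega

open Classical in
theorem stepKernel_singleton {V : Type*} (G : SimpleGraph V) [G.LocallyFinite]
    [Countable V] [MeasurableSpace V] [DiscreteMeasurableSpace V] (u v : V)
    (h : (G.neighborFinset u).Nonempty) : stepKernel G u {v} =
      if v ∈ G.neighborFinset u then ((G.neighborFinset u).card : ℝ≥0∞)⁻¹ else 0 := by
  change (step G u).toMeasure {v} = _
  rw [PMF.toMeasure_apply_singleton _ _ (.singleton v), step, dif_pos h,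
    PMF.uniformOfFinset_apply]

theorem lintegral_stepKernel {V : Type*} (G : SimpleGraph V) [G.LocallyFinite]
    [Countable V] [MeasurableSpace V] [DiscreteMeasurableSpace V] (u : V)
    (h : (G.neighborFinset u).Nonempty) (f : V → ℝ≥0∞) : ∫⁻ y, f y ∂stepKernel G u =
      ((G.neighborFinset u).card : ℝ≥0∞)⁻¹ * ∑ v ∈ G.neighborFinset u, f v := by
  rw [lintegral_countable', tsum_eq_sum (s := G.neighborFinset u), Finset.mul_sum]
  · refine Finset.sum_congr rfl fun v hv => ?_
    rw [stepKernel_singleton G u v h, if_pos hv, mul_comm]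
  · intro v hv
    rw [stepKernel_singleton G u v h, if_neg hv, mul_zero]

theorem nonempty_neighborFinset (hd : 2 ≤ d) (v : TreeVertex d) :
    ((daryTree d).neighborFinset v).Nonempty :=
  ⟨child ⟨0, by omega⟩ v, by
    rw [SimpleGraph.mem_neighborFinset]; exact Or.inl ⟨_, rfl⟩⟩

theorem card_neighborFinset_le (v : TreeVertex d) :
    ((daryTree d).neighborFinset v).card ≤ d + 1 := by
  classical
  rcases eq_root_or_exists_eq_child v with rfl | ⟨i, v, rfl⟩
  · rw [neighborFinset_root]
    exact Finset.card_image_le.trans (by simp)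
  · rw [neighborFinset_child]
    exact (Finset.card_insert_le _ _).trans (by gcongr; exact Finset.card_image_le.trans (by simp))

theorem inv_le_stepKernel (hd : 2 ≤ d) (u v : TreeVertex d)
    (h : stepKernel (daryTree d) u {v} ≠ 0) :
    ((d + 1 : ℕ) : ℝ≥0∞)⁻¹ ≤ stepKernel (daryTree d) u {v} := by
  rw [stepKernel_singleton _ u v (nonempty_neighborFinset hd u)] at h ⊢
  split_ifs at h ⊢ with hv
  · exact ENNReal.inv_le_inv.2 (by exact_mod_cast card_neighborFinset_le u)
  · exact absurd rfl h

/-- The weight `d ^ (-|v| / 2)` of a vertex at distance `|v|` from the root. -/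
def weight (v : TreeVertex d) : ℝ≥0∞ := ENNReal.ofReal ((√d)⁻¹ ^ depth v)

theorem weight_root : weight (treeRoot d) = 1 := by simp [weight]

/-- The spectral radius `2√d / (d + 1)` of simple random walk on the `(d + 1)`-regular tree. -/
def spectralRate (d : ℕ) : ℝ := 2 * √d / (d + 1)

theorem spectralRate_nonneg (d : ℕ) : 0 ≤ spectralRate d := by unfold spectralRate; positivity

theorem spectralRate_lt_one (hd : 2 ≤ d) : spectralRate d < 1 := by
  have h2 : (2 : ℝ) ≤ d := by exact_mod_cast hd
  have hs : √(d : ℝ) ^ 2 = d := Real.sq_sqrt (by linarith)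
  have h1 : 1 < √(d : ℝ) := Real.lt_sqrt_of_sq_lt (by linarith)
  rw [spectralRate, div_lt_one (by linarith)]
  nlinarith

theorem lintegral_weight_le (hd : 2 ≤ d) (v : TreeVertex d) :
    ∫⁻ y, weight y ∂stepKernel (daryTree d) v ≤
      ENNReal.ofReal (spectralRate d) * weight v := by
  classical
  have h2 : (2 : ℝ) ≤ d := by exact_mod_cast hd
  have hs : √(d : ℝ) ^ 2 = d := Real.sq_sqrt (by linarith)
  have h1 : 1 < √(d : ℝ) := Real.lt_sqrt_of_sq_lt (by linarith)
  rw [lintegral_stepKernel _ v (nonempty_neighborFinset hd v)]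
  simp only [weight]
  rw [← ENNReal.ofReal_sum_of_nonneg (fun _ _ => by positivity), ← ENNReal.ofReal_natCast,
    ← ENNReal.ofReal_inv_of_pos (by exact_mod_cast (nonempty_neighborFinset hd v).card_pos),
    ← ENNReal.ofReal_mul (by positivity), ← ENNReal.ofReal_mul (spectralRate_nonneg d)]
  refine ENNReal.ofReal_le_ofReal ?_
  have hsum (u : TreeVertex d) : ∑ x ∈ Finset.univ.image (fun i => child i u),
      (√(d : ℝ))⁻¹ ^ depth x = d * (√(d : ℝ))⁻¹ ^ (depth u + 1) := by
    rw [Finset.sum_image (fun _ _ _ _ h => child_injective u h)]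
    simp [-inv_pow]
  rcases eq_root_or_exists_eq_child v with rfl | ⟨i, v, rfl⟩
  · rw [neighborFinset_root, hsum, Finset.card_image_of_injective _ (child_injective _)]
    simp only [Finset.card_univ, Fintype.card_fin, depth_root, pow_zero, zero_add,
      pow_one, mul_one, spectralRate]
    rw [← mul_assoc, inv_mul_cancel₀ (by linarith), one_mul, le_div_iff₀ (by linarith),
      inv_mul_le_iff₀ (by linarith)]
    nlinarith
  · rw [neighborFinset_child, Finset.sum_insert (notMem_image_child i v),
      Finset.card_insert_of_notMem (notMem_image_child i v), hsum,
      Finset.card_image_of_injective _ (child_injective _)]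
    simp only [Finset.card_univ, Fintype.card_fin, depth_child, spectralRate]
    refine le_of_eq ?_
    have h0 : √(d : ℝ) * (√(d : ℝ))⁻¹ = 1 := mul_inv_cancel₀ (by positivity)
    have hd' : (d : ℝ) * (√(d : ℝ))⁻¹ ^ 2 = 1 := by
      rw [inv_pow, hs]
      exact mul_inv_cancel₀ (by positivity)
    push_cast
    generalize depth v = m
    rw [div_mul_eq_mul_div, inv_mul_eq_div]
    congr 1
    linear_combination (√(d : ℝ))⁻¹ ^ m * hd' - 2 * (√(d : ℝ))⁻¹ ^ m * h0

end Tree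

/-! ### Self-avoiding chains in a product space -/

section Chains

variable {V X : Type*}

section Resampling

variable [MeasurableSpace X] (ν : V → Measure X) [∀ v, IsProbabilityMeasure (ν v)]

open Classical in
theorem map_update_infinitePi (u : V) :
    ((ν u).prod (Measure.infinitePi ν)).map (fun z => Function.update z.2 u z.1) =
      Measure.infinitePi ν := by
  have hm : Measurable fun z : X × (V → X) => Function.update z.2 u z.1 :=
    measurable_update'.comp measurable_swap
  refine Measure.eq_infinitePi ν fun s t ht => ?_
  rw [Measure.map_apply hm (.pi s.countable_toSet fun v _ => ht v)]
  by_cases hu : u ∈ s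
  · have : (fun z : X × (V → X) => Function.update z.2 u z.1) ⁻¹' (Set.pi s t) =
        t u ×ˢ Set.pi (s.erase u : Finset V) t := by
      ext z
      simp only [Set.mem_preimage, Set.mem_pi, Finset.mem_coe, Set.mem_prod, Finset.mem_erase]
      constructor
      · intro h
        refine ⟨by simpa using h u hu, fun v hv => ?_⟩
        simpa [Function.update_of_ne hv.1] using h v hv.2
      · rintro ⟨h1, h2⟩ v hv
        by_cases h : v = u
        · subst h; simpa using h1
        · simpa [Function.update_of_ne h] using h2 v ⟨h, hv⟩
    rw [this, Measure.prod_prod, Measure.infinitePi_pi ν fun v _ => ht v,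
      Finset.mul_prod_erase s (fun v => ν v (t v)) hu]
  · have : (fun z : X × (V → X) => Function.update z.2 u z.1) ⁻¹' (Set.pi s t) =
        Set.univ ×ˢ Set.pi s t := by
      ext z
      simp only [Set.mem_preimage, Set.mem_pi, Finset.mem_coe, Set.mem_prod, Set.mem_univ, true_and]
      refine forall₂_congr fun v hv => ?_
      rw [Function.update_of_ne (ne_of_mem_of_not_mem hv hu)]
    rw [this, Measure.prod_prod, Measure.infinitePi_pi ν fun v _ => ht v, measure_univ, one_mul]

open Classical in
/-- Under a product measure, a function of the coordinate `u` is independent of a function that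
does not depend on the coordinate `u`. -/
theorem lintegral_infinitePi_mul (u : V) {f : X → ℝ≥0∞} (hf : Measurable f)
    {g : (V → X) → ℝ≥0∞} (hg : Measurable g) (h : ∀ ω x, g (Function.update ω u x) = g ω) :
    ∫⁻ ω, f (ω u) * g ω ∂Measure.infinitePi ν =
      (∫⁻ x, f x ∂ν u) * ∫⁻ ω, g ω ∂Measure.infinitePi ν := by
  have hm : Measurable fun z : X × (V → X) => Function.update z.2 u z.1 :=
    measurable_update'.comp measurable_swap
  have hfg : Measurable fun ω : V → X => f (ω u) * g ω :=
    (hf.comp (measurable_pi_apply u)).mul hg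
  conv_lhs => rw [← map_update_infinitePi ν u, lintegral_map hfg hm]
  simp only [Function.update_self, h]
  exact lintegral_prod_mul hf.aemeasurable hg.aemeasurable

end Resampling

open Classical in
/-- The sum over all self-avoiding chains `u = u₀, u₁, …, uₖ = v` that avoid the forbidden set `S`
after their first vertex, of the product of the weights `a uⱼ uⱼ₊₁ (ω uⱼ)` of the links and of the
weight `b v (ω v)` of the last vertex. -/
def chainSum (a : V → V → X → ℝ≥0∞) (b : V → X → ℝ≥0∞) (v : V) :
    ℕ → V → Finset V → (V → X) → ℝ≥0∞
  | 0, u, _, ω => if u = v then b v (ω v) else 0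
  | k + 1, u, S, ω =>
    ∑' x, if x ∈ insert u S then 0 else a u x (ω u) * chainSum a b v k x (insert u S) ω

variable {a : V → V → X → ℝ≥0∞} {b : V → X → ℝ≥0∞}

open Classical in
theorem chainSum_update (v : V) (k : ℕ) (y : V) (S : Finset V) {u : V} (hu : u ∈ S) (hy : y ∉ S)
    (ω : V → X) (x : X) :
    chainSum a b v k y S (Function.update ω u x) = chainSum a b v k y S ω := by
  induction k generalizing y S with
  | zero =>
    unfold chainSum
    split_ifs with h
    · rw [Function.update_of_ne (h ▸ (ne_of_mem_of_not_mem hu hy).symm)]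
    · rfl
  | succ k ih =>
    unfold chainSum
    refine tsum_congr fun z => ?_
    split_ifs with hz
    · rfl
    · rw [Function.update_of_ne (ne_of_mem_of_not_mem hu hy).symm,
        ih z _ (Finset.mem_insert_of_mem hu) hz]

variable [Countable V] [MeasurableSpace X]

theorem measurable_chainSum (ha : ∀ u v, Measurable (a u v)) (hb : ∀ v, Measurable (b v))
    (v : V) (k : ℕ) (u : V) (S : Finset V) : Measurable (chainSum a b v k u S) := by
  classical
  induction k generalizing u S with
  | zero =>
    change Measurable fun ω => chainSum a b v 0 u S ω
    simp only [chainSum]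
    split_ifs with h
    · exact (hb v).comp (measurable_pi_apply v)
    · exact measurable_const
  | succ k ih =>
    change Measurable fun ω => chainSum a b v (k + 1) u S ω
    simp only [chainSum]
    refine Measurable.tsum fun x => ?_
    split_ifs with h
    · exact measurable_const
    · exact ((ha u x).comp (measurable_pi_apply u)).mul (ih x _)

variable (ν : V → Measure X) [∀ v, IsProbabilityMeasure (ν v)]

open Classical in
/-- The expectation of a chain sum factorizes, because the vertices of a chain are distinct. -/
theorem lintegral_chainSum_succ (ha : ∀ u v, Measurable (a u v)) (hb : ∀ v, Measurable (b v))
    (v : V) (k : ℕ) (u : V) (S : Finset V) :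
    ∫⁻ ω, chainSum a b v (k + 1) u S ω ∂Measure.infinitePi ν =
      ∑' x, if x ∈ insert u S then 0 else (∫⁻ y, a u x y ∂ν u) *
        ∫⁻ ω, chainSum a b v k x (insert u S) ω ∂Measure.infinitePi ν := by
  simp only [chainSum]
  rw [lintegral_tsum]
  · refine tsum_congr fun x => ?_
    split_ifs with hx
    · simp
    · exact lintegral_infinitePi_mul ν u (ha u x) (measurable_chainSum ha hb v k x _)
        fun ω y => chainSum_update v k x _ (Finset.mem_insert_self u S) hx ω y
  · intro x
    split_ifs with hx
    · exact aemeasurable_const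
    · exact (((ha u x).comp (measurable_pi_apply u)).mul
        (measurable_chainSum ha hb v k x _)).aemeasurable

variable {w : V → ℝ≥0∞} {r B : ℝ≥0∞} {root : V}

/-- If the expected weight of the links out of any vertex is at most `r` times the weight of the
vertex, then chain sums decay like `r ^ k` in the length `k` of the chain. The root is exempt from
the hypothesis, being in the forbidden set. -/
theorem tsum_lintegral_chainSum_le (ha : ∀ u v, Measurable (a u v)) (hb : ∀ v, Measurable (b v))
    (hq : ∀ u ≠ root, ∑' x, (∫⁻ y, a u x y ∂ν u) * w x ≤ r * w u)
    (hB : ∀ u ≠ root, ∫⁻ y, b u y ∂ν u ≤ B * w u) (k : ℕ) (u : V) (S : Finset V)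
    (hS : root ∈ S) (hu : u ∉ S) :
    ∑' v, ∫⁻ ω, chainSum a b v k u S ω ∂Measure.infinitePi ν ≤ B * r ^ k * w u := by
  classical
  have hne (u : V) (hu : u ∉ S) : u ≠ root := (ne_of_mem_of_not_mem hS hu).symm
  induction k generalizing u S with
  | zero =>
    rw [tsum_eq_single u]
    · have : ∫⁻ ω, b u (ω u) ∂Measure.infinitePi ν = ∫⁻ y, b u y ∂ν u := by
        rw [← Measure.infinitePi_map_eval ν u, lintegral_map (hb u) (measurable_pi_apply u)]
      simpa [chainSum, this] using hB u (hne u hu)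
    · intro v hv
      simp [chainSum, hv.symm]
  | succ k ih =>
    simp only [lintegral_chainSum_succ ν ha hb]
    rw [ENNReal.tsum_comm]
    calc _ ≤ ∑' x, (B * r ^ k) * ((∫⁻ y, a u x y ∂ν u) * w x) := by
          refine ENNReal.tsum_le_tsum fun x => ?_
          by_cases hx : x ∈ insert u S
          · simp [hx]
          · have hS' : root ∈ insert u S := Finset.mem_insert_of_mem hS
            simp only [hx, if_false]
            rw [ENNReal.tsum_mul_left]
            calc _ ≤ (∫⁻ y, a u x y ∂ν u) * (B * r ^ k * w x) := by
                  gcongr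
                  exact ih x _ hS' hx fun y hy => (ne_of_mem_of_not_mem hS' hy).symm
              _ = _ := by ring
      _ = B * r ^ k * ∑' x, (∫⁻ y, a u x y ∂ν u) * w x := ENNReal.tsum_mul_left
      _ ≤ B * r ^ k * (r * w u) := by gcongr; exact hq u (hne u hu)
      _ = _ := by ring

/-- If `r < 1`, then the total weight of all self-avoiding chains that start at the root has finite
expectation. -/
theorem tsum_tsum_lintegral_chainSum_root_ne_top (ha : ∀ u v, Measurable (a u v))
    (hb : ∀ v, Measurable (b v))
    (hq : ∀ u ≠ root, ∑' x, (∫⁻ y, a u x y ∂ν u) * w x ≤ r * w u)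
    (hB : ∀ u ≠ root, ∫⁻ y, b u y ∂ν u ≤ B * w u) (hr : r < 1) (hB' : B ≠ ∞)
    (hq_root : ∑' x, (∫⁻ y, a root x y ∂ν root) * w x ≠ ∞)
    (hB_root : ∫⁻ y, b root y ∂ν root ≠ ∞) :
    ∑' k, ∑' v, ∫⁻ ω, chainSum a b v k root ∅ ω ∂Measure.infinitePi ν ≠ ∞ := by
  classical
  rw [tsum_eq_zero_add' ENNReal.summable]
  refine ENNReal.add_ne_top.2 ⟨?_, ?_⟩
  · rw [tsum_eq_single root]
    · have : ∫⁻ ω, b root (ω root) ∂Measure.infinitePi ν = ∫⁻ y, b root y ∂ν root := by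
        rw [← Measure.infinitePi_map_eval ν root,
          lintegral_map (hb root) (measurable_pi_apply root)]
      simpa [chainSum, this] using hB_root
    · intro v hv
      simp [chainSum, hv.symm]
  · refine ne_top_of_le_ne_top (b := ∑' k, B * r ^ k *
      ∑' x, (∫⁻ y, a root x y ∂ν root) * w x) ?_ (ENNReal.tsum_le_tsum fun k => ?_)
    · rw [ENNReal.tsum_mul_right, ENNReal.tsum_mul_left, ENNReal.tsum_geometric]
      exact ENNReal.mul_ne_top (ENNReal.mul_ne_top hB'
        (ENNReal.inv_ne_top.2 (tsub_pos_of_lt hr).ne')) hq_root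
    · simp only [lintegral_chainSum_succ ν ha hb]
      rw [ENNReal.tsum_comm, ← ENNReal.tsum_mul_left]
      refine ENNReal.tsum_le_tsum fun x => ?_
      by_cases hx : x ∈ insert root (∅ : Finset V)
      · simp only [hx, if_true, tsum_zero]
        exact zero_le
      · simp only [hx, if_false]
        rw [ENNReal.tsum_mul_left]
        calc _ ≤ (∫⁻ y, a root x y ∂ν root) * (B * r ^ k * w x) := by
              gcongr
              exact tsum_lintegral_chainSum_le ν ha hb hq hB k x _
                (Finset.mem_insert_self _ _) hx
          _ = _ := by ring

end Chains

/-! ### Chains of activations -/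

section Dynamics

variable {V : Type*} {root : V} {ω : Realization V}

theorem wakeTime_le {t s : ℕ} {v : V} (h : wakeTime root ω t v = some s) : s ≤ t := by
  induction t with
  | zero =>
    simp only [wakeTime] at h
    split_ifs at h
    simp_all
  | succ t ih =>
    rw [wakeTime] at h
    split at h
    next s' hs' => exact (ih (hs'.trans h)).trans t.le_succ
    next =>
      split_ifs at h
      exact (Option.some.inj h).ge

theorem wakeTime_mono {t t' s : ℕ} {v : V} (h : wakeTime root ω t v = some s) (ht : t ≤ t') :
    wakeTime root ω t' v = some s := by
  induction t', ht using Nat.le_induction with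
  | base => exact h
  | succ t' _ ih => rw [wakeTime, ih]

theorem wakeTime_unique {t t' s s' : ℕ} {v : V} (h : wakeTime root ω t v = some s)
    (h' : wakeTime root ω t' v = some s') : s = s' :=
  Option.some.inj ((wakeTime_mono h (le_max_left t t')).symm.trans
    (wakeTime_mono h' (le_max_right t t')))

/-- Some particle of `u`, once active, visits `v`. -/
def Visits (root : V) (u v : V) (x : ℕ × (ℕ → ℕ → V)) : Prop :=
  ∃ i n, i < numParticles root (fun _ => x) u ∧ x.2 i n = v

open Classical in
/-- The number of visits to the root by the particles of `u`, once active. -/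
def rootVisits (root : V) (u : V) (x : ℕ × (ℕ → ℕ → V)) : ℝ≥0∞ :=
  ∑' p : ℕ × ℕ, if p.1 < numParticles root (fun _ => x) u ∧ x.2 p.1 p.2 = root then 1 else 0

open Classical in
/-- The weight of the link from `u` to `v` in a chain of activations: the indicator of the event
that a particle of `u` visits `v`. -/
def link (root : V) (u v : V) (x : ℕ × (ℕ → ℕ → V)) : ℝ≥0∞ := if Visits root u v x then 1 else 0

/-- A vertex other than the root is woken up by a vertex with a smaller wake time. -/
theorem exists_visits_of_wakeTime {t s : ℕ} {v : V} (h : wakeTime root ω t v = some s)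
    (hv : v ≠ root) :
    ∃ u s' t', wakeTime root ω t' u = some s' ∧ s' < s ∧ Visits root u v (ω u) := by
  induction t with
  | zero => simp [wakeTime, hv] at h
  | succ t ih =>
    rw [wakeTime] at h
    split at h
    next s' hs' => exact ih (hs'.trans h)
    next =>
      split_ifs at h with hex
      obtain ⟨u, i, s', hs', hi, hiv⟩ := hex
      obtain rfl := Option.some.inj h
      exact ⟨u, s', t, hs', Nat.lt_succ_of_le (wakeTime_le hs'), i, _, hi, hiv⟩

/-- A vertex that ever wakes up is the end of a self-avoiding chain of activations from the root.
The chain is built backwards from `v`; it is self-avoiding since wake times increase along it. -/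
theorem exists_le_chainSum {b : V → ℕ × (ℕ → ℕ → V) → ℝ≥0∞} {t s : ℕ} {v : V}
    (h : wakeTime root ω t v = some s) :
    ∃ k, b v (ω v) ≤ chainSum (link root) b v k root ∅ ω := by
  classical
  have key : ∀ s u, (∃ t, wakeTime root ω t u = some s) →
      (∃ k, ∀ S : Finset V, (∀ x ∈ S, ∃ s' t', wakeTime root ω t' x = some s' ∧ s' < s) →
        b v (ω v) ≤ chainSum (link root) b v k u S ω) →
      ∃ k, b v (ω v) ≤ chainSum (link root) b v k root ∅ ω := by
    intro s
    induction s using Nat.strong_induction_on with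
    | _ s ih =>
      rintro u ⟨t, ht⟩ ⟨k, hk⟩
      by_cases hu : u = root
      · subst hu
        exact ⟨k, hk ∅ (by simp)⟩
      obtain ⟨p, s', t', hp, hs', hvis⟩ := exists_visits_of_wakeTime ht hu
      refine ih s' hs' p ⟨t', hp⟩ ⟨k + 1, fun S hS => ?_⟩
      have huS : u ∉ insert p S := by
        rw [Finset.mem_insert, not_or]
        constructor
        · rintro rfl
          exact hs'.ne (wakeTime_unique hp ht)
        · intro hmem
          obtain ⟨s'', t'', h1, h2⟩ := hS u hmem
          exact (h2.trans hs').ne (wakeTime_unique h1 ht)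
      rw [chainSum]
      refine le_trans ?_ (ENNReal.le_tsum u)
      rw [if_neg huS, link, if_pos hvis, one_mul]
      refine hk _ fun x hx => ?_
      rcases Finset.mem_insert.1 hx with rfl | hx
      · exact ⟨s', t', hp, hs'⟩
      · obtain ⟨s'', t'', h1, h2⟩ := hS x hx
        exact ⟨s'', t'', h1, h2.trans hs'⟩
  exact key s v ⟨t, h⟩ ⟨0, fun S _ => by simp [chainSum]⟩

/-- Finiteness of the total weight of the chains from the root, each weighted by the number of
visits to the root by the particles of its last vertex, implies transience. -/
theorem transient_of_tsum_chainSum_ne_top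
    (h : ∑' k, ∑' v, chainSum (link root) (rootVisits root) v k root ∅ ω ≠ ∞) :
    Transient root ω := by
  classical
  set F : Set (V × ℕ × ℕ) := {q | (∃ t s, wakeTime root ω t q.1 = some s) ∧
    q.2.1 < numParticles root ω q.1 ∧ (ω q.1).2 q.2.1 q.2.2 = root}
  have hF : F.Finite := by
    have hsum : ∑' q, F.indicator (1 : V × ℕ × ℕ → ℝ≥0∞) q ≠ ∞ := by
      refine ne_top_of_le_ne_top h ?_
      rw [ENNReal.tsum_comm, ENNReal.tsum_prod']
      refine ENNReal.tsum_le_tsum fun v => ?_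
      by_cases hv : ∃ t s, wakeTime root ω t v = some s
      · obtain ⟨t, s, hts⟩ := hv
        obtain ⟨k, hk⟩ := exists_le_chainSum (b := rootVisits root) hts
        refine le_trans (le_trans ?_ hk) (ENNReal.le_tsum k)
        refine ENNReal.tsum_le_tsum fun p => ?_
        by_cases hp : p.1 < numParticles root ω v ∧ (ω v).2 p.1 p.2 = root
        · exact Set.indicator_le_self' (by simp) _ |>.trans (le_of_eq (if_pos hp).symm)
        · rw [Set.indicator_of_notMem fun hmem => hp hmem.2]
          exact zero_le
      · refine le_trans (le_of_eq ?_) zero_le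
        refine ENNReal.tsum_eq_zero.2 fun p => ?_
        exact Set.indicator_of_notMem (fun hmem => hv hmem.1) _
    refine (ENNReal.finite_const_le_of_tsum_ne_top hsum one_ne_zero).subset fun q hq => ?_
    simp [Set.indicator_of_mem hq]
  rw [Transient, Recurrent, Set.not_infinite]
  -- The number of steps since the activation, with the particle, determines the time.
  refine Set.Finite.of_injOn (t := F)
    (f := fun p => (p.2.1, p.2.2, p.1 - (wakeTime root ω p.1 p.2.1).getD 0)) ?_ ?_ hF
  · rintro ⟨t, u, i⟩ ⟨s, hs, hi, hx⟩
    refine ⟨⟨t, s, hs⟩, hi, ?_⟩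
    simpa only [hs, Option.getD_some] using hx
  · rintro ⟨t, u, i⟩ ⟨s, hs, -⟩ ⟨t', u', i'⟩ ⟨s', hs', -⟩ heq
    simp only [Prod.mk.injEq] at heq hs hs' ⊢
    obtain ⟨rfl, rfl, h3⟩ := heq
    obtain rfl := wakeTime_unique hs hs'
    rw [hs, hs', Option.getD_some] at h3
    have := wakeTime_le hs
    have := wakeTime_le hs'
    exact ⟨by omega, rfl, rfl⟩

end Dynamics

/-! ### First-moment estimates -/

section Estimates

theorem measurable_numParticles {V : Type*} [MeasurableSpace V] (root u : V) :
    Measurable fun x : ℕ × (ℕ → ℕ → V) => numParticles root (fun _ => x) u := by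
  unfold numParticles
  split_ifs
  · exact measurable_const
  · exact measurable_fst

variable {V : Type*} [Countable V] [MeasurableSpace V] [DiscreteMeasurableSpace V] (root : V)

theorem measurableSet_particle_at (u v : V) (i n : ℕ) :
    MeasurableSet {x : ℕ × (ℕ → ℕ → V) | i < numParticles root (fun _ => x) u ∧ x.2 i n = v} := by
  have h : Measurable fun x : ℕ × (ℕ → ℕ → V) => x.2 i n :=
    (measurable_pi_apply n).comp ((measurable_pi_apply i).comp measurable_snd)
  exact (measurable_numParticles root u (Set.to_countable (Set.Ioi i)).measurableSet).inter
    (h (.singleton v))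

theorem measurable_link (u v : V) : Measurable (link root u v) := by
  refine Measurable.ite ?_ measurable_const measurable_const
  simp only [Visits, Set.ofPred_exists]
  exact .iUnion fun i => .iUnion fun n => measurableSet_particle_at root u v i n

theorem measurable_rootVisits (u : V) : Measurable (rootVisits root u) :=
  .tsum fun p => .ite (measurableSet_particle_at root u root p.1 p.2)
    measurable_const measurable_const

variable (G : SimpleGraph V) [G.LocallyFinite]

/-- The joint law of the paths of the particles of the vertex `u`. -/
def pathsLaw (u : V) : Measure (ℕ → ℕ → V) := Measure.infinitePi fun _ : ℕ => walkLaw G u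

instance (u : V) : IsProbabilityMeasure (pathsLaw G u) := by unfold pathsLaw; infer_instance

theorem pathsLaw_eval_eq (u v : V) (i n : ℕ) :
    pathsLaw G u {y | y i n = v} = heatKernel G n u v := by
  rw [heatKernel, ← Measure.infinitePi_map_eval (fun _ : ℕ => walkLaw G u) i,
    Measure.map_apply (measurable_pi_apply i) (measurableSet_eval_eq n v)]
  rfl

theorem measurableSet_path_eq (v : V) (i n : ℕ) : MeasurableSet {y : ℕ → ℕ → V | y i n = v} :=
  (measurable_pi_apply (X := fun _ : ℕ => ℕ → V) i) (measurableSet_eval_eq n v)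

theorem pathsLaw_exists_le_sum (u v : V) (n N : ℕ) :
    pathsLaw G u {y | ∃ i < N, y i n = v} ≤ N * heatKernel G n u v := by
  have : {y : ℕ → ℕ → V | ∃ i < N, y i n = v} = ⋃ i ∈ Finset.range N, {y | y i n = v} := by
    ext y; simp
  rw [this]
  refine (measure_biUnion_finset_le _ _).trans (le_of_eq ?_)
  simp [pathsLaw_eval_eq]

theorem pathsLaw_exists_exists_le_tsum (u v : V) (N : ℕ) :
    pathsLaw G u {y | ∃ i n, i < N ∧ y i n = v} ≤
      ∑' n, pathsLaw G u {y | ∃ i < N, y i n = v} := by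
  refine (measure_mono ?_).trans (measure_iUnion_le _)
  rintro y ⟨i, n, hi, hy⟩
  exact Set.mem_iUnion.2 ⟨n, i, hi, hy⟩

/-- The probability that one of `N` walks is at `v` at time `n` is at most `N` times that of a
single walk, but also at most `1`; the latter is the better bound when `n` is small compared to
`log N`. -/
theorem pathsLaw_exists_le_min {c : ℝ≥0∞} (hc0 : c ≠ 0)
    (hc : ∀ u v, stepKernel G u {v} ≠ 0 → c ≤ stepKernel G u {v}) (u v : V) (n N : ℕ) :
    pathsLaw G u {y | ∃ i < N, y i n = v} ≤ min (c ^ n)⁻¹ N * heatKernel G n u v := by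
  have h1 := pathsLaw_exists_le_sum G u v n N
  rcases eq_or_ne (heatKernel G n u v) 0 with h0 | h0
  · simpa [h0] using h1
  rcases le_total (c ^ n)⁻¹ (N : ℝ≥0∞) with h | h
  · rw [min_eq_left h]
    have hcn : c ^ n ≤ heatKernel G n u v := pow_le_heatKernel G hc n u v h0
    have hcn' : c ^ n ≠ ∞ :=
      ne_top_of_le_ne_top ENNReal.one_ne_top (hcn.trans prob_le_one)
    calc _ ≤ 1 := prob_le_one
      _ = (c ^ n)⁻¹ * c ^ n := (ENNReal.inv_mul_cancel (pow_ne_zero n hc0) hcn').symm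
      _ ≤ _ := by gcongr
  · rwa [min_eq_right h]

open Classical in
theorem lintegral_pathsLaw_visits (u v : V) (N : ℕ) :
    ∫⁻ y, ∑' p : ℕ × ℕ, (if p.1 < N ∧ y p.1 p.2 = v then (1 : ℝ≥0∞) else 0) ∂pathsLaw G u =
      N * ∑' n, heatKernel G n u v := by
  have hmeas (p : ℕ × ℕ) : MeasurableSet {y : ℕ → ℕ → V | p.1 < N ∧ y p.1 p.2 = v} :=
    (MeasurableSet.const _).inter (measurableSet_path_eq v p.1 p.2)
  have hterm (p : ℕ × ℕ) :
      ∫⁻ y, (if p.1 < N ∧ y p.1 p.2 = v then (1 : ℝ≥0∞) else 0) ∂pathsLaw G u =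
        if p.1 < N then heatKernel G p.2 u v else 0 := by
    split_ifs with h
    · simp only [h, true_and]
      rw [← pathsLaw_eval_eq G u v p.1 p.2,
        ← lintegral_indicator_one (measurableSet_path_eq v p.1 p.2)]
      simp only [Set.indicator_apply, Set.mem_ofPred_eq, Pi.one_apply]
    · simp [h]
  rw [lintegral_tsum fun p =>
    (Measurable.ite (hmeas p) measurable_const measurable_const).aemeasurable]
  simp only [hterm]
  rw [ENNReal.tsum_prod', tsum_eq_sum (s := Finset.range N)]
  · rw [Finset.sum_congr rfl fun i hi =>
      tsum_congr fun n => if_pos (show (i, n).1 < N from Finset.mem_range.1 hi)]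
    simp
  · intro i hi
    rw [Finset.mem_range] at hi
    simp [hi]

variable {root G}
variable {w : V → ℝ≥0∞} {ρ : ℝ≥0∞}

theorem tsum_heatKernel_root_le (hw : ∀ v, ∫⁻ y, w y ∂stepKernel G v ≤ ρ * w v)
    (hroot : w root = 1) (u : V) : ∑' n, heatKernel G n u root ≤ (1 - ρ)⁻¹ * w u := by
  rw [← ENNReal.tsum_geometric, ← ENNReal.tsum_mul_right]
  refine ENNReal.tsum_le_tsum fun n => le_trans ?_ (tsum_heatKernel_mul_le G hw n u)
  refine le_trans (le_of_eq ?_) (ENNReal.le_tsum root)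
  rw [hroot, mul_one]

/-- A bound on the expected total weight of the vertices visited by `N` walks from `u`. -/
theorem tsum_pathsLaw_visits_mul_le (hw : ∀ v, ∫⁻ y, w y ∂stepKernel G v ≤ ρ * w v) {c : ℝ≥0∞}
    (hc0 : c ≠ 0) (hc : ∀ u v, stepKernel G u {v} ≠ 0 → c ≤ stepKernel G u {v}) (u : V) (N : ℕ) :
    ∑' v, pathsLaw G u {y | ∃ i n, i < N ∧ y i n = v} * w v ≤
      (∑' n, min (c ^ n)⁻¹ N * ρ ^ n) * w u := by
  calc _ ≤ ∑' v, ∑' n, min (c ^ n)⁻¹ (N : ℝ≥0∞) * heatKernel G n u v * w v := by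
        refine ENNReal.tsum_le_tsum fun v => ?_
        rw [ENNReal.tsum_mul_right]
        gcongr
        exact (pathsLaw_exists_exists_le_tsum G u v N).trans
          (ENNReal.tsum_le_tsum fun n => pathsLaw_exists_le_min G hc0 hc u v n N)
    _ = ∑' n, min (c ^ n)⁻¹ (N : ℝ≥0∞) * ∑' v, heatKernel G n u v * w v := by
        rw [ENNReal.tsum_comm]
        simp only [mul_assoc, ENNReal.tsum_mul_left]
    _ ≤ ∑' n, min (c ^ n)⁻¹ (N : ℝ≥0∞) * (ρ ^ n * w u) := by
        gcongr with n
        exact tsum_heatKernel_mul_le G hw n u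
    _ = _ := by simp only [← mul_assoc, ENNReal.tsum_mul_right]

theorem lintegral_two_point_prod {π : Measure ℕ} {Y : Type*} [MeasurableSpace Y]
    (κ : Measure Y) [IsProbabilityMeasure κ] {N : ℕ} {m m₀ : ℝ≥0∞}
    (hπ : π = m • Measure.dirac N + m₀ • Measure.dirac 0) {f : ℕ × Y → ℝ≥0∞} (hf : Measurable f) :
    ∫⁻ x, f x ∂π.prod κ = m * ∫⁻ y, f (N, y) ∂κ + m₀ * ∫⁻ y, f (0, y) ∂κ := by
  rw [lintegral_prod _ hf.aemeasurable, hπ, lintegral_add_measure, lintegral_smul_measure,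
    lintegral_smul_measure, lintegral_dirac, lintegral_dirac]
  rfl

open Classical in
theorem lintegral_link_pathsLaw (u v : V) (M k : ℕ)
    (hM : ∀ y : ℕ → ℕ → V, numParticles root (fun _ => (k, y)) u = M) :
    ∫⁻ y, link root u v (k, y) ∂pathsLaw G u =
      pathsLaw G u {y | ∃ i n, i < M ∧ y i n = v} := by
  have hm : MeasurableSet {y : ℕ → ℕ → V | ∃ i n, i < M ∧ y i n = v} := by
    simp only [Set.ofPred_exists]
    exact .iUnion fun i => .iUnion fun n =>
      (MeasurableSet.const _).inter (measurableSet_path_eq v i n)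
  rw [← lintegral_indicator_one hm]
  simp only [link, Visits, hM]
  rfl

theorem lintegral_rootVisits_pathsLaw (u : V) (M k : ℕ)
    (hM : ∀ y : ℕ → ℕ → V, numParticles root (fun _ => (k, y)) u = M) :
    ∫⁻ y, rootVisits root u (k, y) ∂pathsLaw G u = M * ∑' n, heatKernel G n u root := by
  classical
  rw [← lintegral_pathsLaw_visits G u root M]
  simp only [rootVisits, hM]

/-- The first-moment criterion for transience: if `w` contracts by `ρ < 1` under one step of the
walk and the activated vertices have mean weight smaller than that of the vertex that activates
them, then the frog model is transient. -/
theorem ae_transient (hw : ∀ v, ∫⁻ y, w y ∂stepKernel G v ≤ ρ * w v) (hroot : w root = 1)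
    (hρ : ρ < 1) {c : ℝ≥0∞} (hc0 : c ≠ 0)
    (hc : ∀ u v, stepKernel G u {v} ≠ 0 → c ≤ stepKernel G u {v})
    (π : ProbabilityMeasure ℕ) {N : ℕ} {m m₀ : ℝ≥0∞}
    (hπ : (π : Measure ℕ) = m • Measure.dirac N + m₀ • Measure.dirac 0)
    (hr : m * ∑' n, min (c ^ n)⁻¹ (N : ℝ≥0∞) * ρ ^ n < 1) :
    ∀ᵐ ω ∂law G π, Transient root ω := by
  have hρ' : (1 - ρ)⁻¹ ≠ ∞ := ENNReal.inv_ne_top.2 (tsub_pos_of_lt hρ).ne'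
  have hsum : m + m₀ = 1 := by
    have := congrArg (fun κ : Measure ℕ => κ Set.univ) hπ
    simpa using this.symm
  have hm : m ≠ ∞ := ne_top_of_le_ne_top ENNReal.one_ne_top (hsum ▸ le_self_add)
  have hint (u : V) {f : ℕ × (ℕ → ℕ → V) → ℝ≥0∞} (hf : Measurable f) :=
    lintegral_two_point_prod (pathsLaw G u) hπ hf
  have hnum (u : V) (hu : u ≠ root) (k : ℕ) (y : ℕ → ℕ → V) :
      numParticles root (fun _ => (k, y)) u = k := if_neg hu
  have hnum_root (k : ℕ) (y : ℕ → ℕ → V) : numParticles root (fun _ => (k, y)) root = 1 :=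
    if_pos rfl
  let ν (u : V) : Measure (ℕ × (ℕ → ℕ → V)) := (π : Measure ℕ).prod (pathsLaw G u)
  have key := tsum_tsum_lintegral_chainSum_root_ne_top ν (w := w) (root := root)
    (r := m * ∑' n, min (c ^ n)⁻¹ (N : ℝ≥0∞) * ρ ^ n) (B := m * N * (1 - ρ)⁻¹)
    (measurable_link root) (measurable_rootVisits root) ?_ ?_ hr ?_ ?_ ?_
  · have hmeas (k : ℕ) (v : V) :=
      measurable_chainSum (measurable_link root) (measurable_rootVisits root) v k root ∅
    simp only [← lintegral_tsum fun v => (hmeas _ v).aemeasurable] at key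
    rw [← lintegral_tsum fun k => (Measurable.tsum (hmeas k)).aemeasurable] at key
    filter_upwards [ae_lt_top (.tsum fun k => .tsum (hmeas k)) key] with ω hω
    exact transient_of_tsum_chainSum_ne_top hω.ne
  · intro u hu
    calc _ = ∑' v, m * (pathsLaw G u {y | ∃ i n, i < N ∧ y i n = v} * w v) := by
          refine tsum_congr fun v => ?_
          rw [hint u (measurable_link root u v), lintegral_link_pathsLaw u v N N (hnum u hu N),
            lintegral_link_pathsLaw u v 0 0 (hnum u hu 0)]
          simp [mul_assoc]
      _ ≤ _ := by
          rw [ENNReal.tsum_mul_left, mul_assoc]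
          gcongr
          exact tsum_pathsLaw_visits_mul_le hw hc0 hc u N
  · intro u hu
    rw [hint u (measurable_rootVisits root u), lintegral_rootVisits_pathsLaw u N N (hnum u hu N),
      lintegral_rootVisits_pathsLaw u 0 0 (hnum u hu 0), Nat.cast_zero, zero_mul, mul_zero, add_zero,
      mul_assoc, mul_assoc]
    gcongr
    exact tsum_heatKernel_root_le hw hroot u
  · exact ENNReal.mul_ne_top (ENNReal.mul_ne_top hm (ENNReal.natCast_ne_top N)) hρ'
  · -- The single particle at the root visits vertices of total weight at most `∑ ρ ^ n`.
    refine ne_top_of_le_ne_top hρ' ?_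
    calc _ = ∑' v, pathsLaw G root {y | ∃ i n, i < 1 ∧ y i n = v} * w v := by
          refine tsum_congr fun v => ?_
          rw [hint root (measurable_link root root v),
            lintegral_link_pathsLaw root v 1 N (hnum_root N),
            lintegral_link_pathsLaw root v 1 0 (hnum_root 0), ← add_mul, hsum, one_mul]
      _ ≤ (∑' n, min (c ^ n)⁻¹ ((1 : ℕ) : ℝ≥0∞) * ρ ^ n) * w root :=
          tsum_pathsLaw_visits_mul_le hw hc0 hc root 1
      _ ≤ ∑' n, 1 * ρ ^ n := by
          rw [hroot, mul_one]
          gcongr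
          exact (min_le_right _ _).trans (by simp)
      _ = _ := by simp only [one_mul, ENNReal.tsum_geometric]
  · rw [hint root (measurable_rootVisits root root),
      lintegral_rootVisits_pathsLaw root 1 N (hnum_root N),
      lintegral_rootVisits_pathsLaw root 1 0 (hnum_root 0), ← add_mul, hsum, one_mul, Nat.cast_one,
      one_mul]
    refine ne_top_of_le_ne_top hρ' ((tsum_heatKernel_root_le hw hroot root).trans ?_)
    rw [hroot, mul_one]

end Estimates

open Filter Topology in
/-- The bound on the mean relative weight of the occupied vertices that an occupied vertex
activates tends to `0` as its number `N` of particles grows, the mean number `μ` of particles per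
vertex being fixed. -/
theorem tendsto_branching_rate (μ ρ C : ℝ) (hμ : 0 ≤ μ) (hρ0 : 0 ≤ ρ) (hρ : ρ < 1) (hC : 0 ≤ C) :
    Tendsto (fun N : ℕ => ∑' n : ℕ, μ / N * (min (C ^ n) N * ρ ^ n)) atTop (𝓝 0) := by
  have h : Tendsto (fun N : ℕ => ∑' n : ℕ, μ / N * (min (C ^ n) N * ρ ^ n)) atTop
      (𝓝 (∑' _ : ℕ, (0 : ℝ))) := by
    refine tendsto_tsum_of_dominated_convergence (bound := fun n => μ * ρ ^ n)
      ((summable_geometric_of_lt_one hρ0 hρ).mul_left μ) (fun n => ?_) ?_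
    · have h0 : Tendsto (fun N : ℕ => μ / N * (C ^ n * ρ ^ n)) atTop (𝓝 0) := by
        simpa using (tendsto_const_div_atTop_nhds_zero_nat μ).mul_const (C ^ n * ρ ^ n)
      refine squeeze_zero (fun N => by positivity) (fun N => ?_) h0
      gcongr
      exact min_le_left _ _
    · refine Eventually.of_forall fun N n => ?_
      rw [Real.norm_of_nonneg (by positivity)]
      rcases N.eq_zero_or_pos with rfl | hN
      · simpa using by positivity
      · have hN' : (0 : ℝ) < N := by exact_mod_cast hN
        calc μ / N * (min (C ^ n) N * ρ ^ n) ≤ μ / N * (N * ρ ^ n) := by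
              gcongr
              exact min_le_right _ _
          _ = μ * ρ ^ n := by field_simp
  simpa using h

end

end FrogModel

theorem theorem1 (d : ℕ) (hd : 2 ≤ d) (μ : ℝ) (hμ : 0 < μ) :
    ∃ N₀ : ℕ, ∀ N : ℕ, N₀ ≤ N → ∃ π : ProbabilityMeasure ℕ,
      (π : Measure ℕ) = ENNReal.ofReal (μ / N) • Measure.dirac N
          + ENNReal.ofReal (1 - μ / N) • Measure.dirac 0 ∧
      ∫⁻ k, (k : ℝ≥0∞) ∂(π : Measure ℕ) = ENNReal.ofReal μ ∧
      ∀ᵐ ω ∂(FrogModel.law (FrogModel.daryTree d) π),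
        FrogModel.Transient (FrogModel.treeRoot d) ω := by
  have hρ0 := FrogModel.spectralRate_nonneg d
  have hρ1 := FrogModel.spectralRate_lt_one hd
  obtain ⟨N₁, hN₁⟩ := Filter.eventually_atTop.1
    ((FrogModel.tendsto_branching_rate μ (FrogModel.spectralRate d) (d + 1) hμ.le hρ0 hρ1
      (by positivity)).eventually_lt_const one_pos)
  refine ⟨max N₁ (max 1 ⌈μ⌉₊), fun N hN => ?_⟩
  have hN1 : N₁ ≤ N := (le_max_left _ _).trans hN
  have hNpos : (0 : ℝ) < N := by
    have : 1 ≤ N := ((le_max_left _ _).trans (le_max_right _ _)).trans hN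
    exact_mod_cast this
  have hNμ : μ ≤ N :=
    Nat.ceil_le.1 (((le_max_right _ _).trans (le_max_right _ _)).trans hN)
  have hm0 : 0 ≤ μ / N := by positivity
  have hm1 : μ / N ≤ 1 := (div_le_one hNpos).2 hNμ
  let π : ProbabilityMeasure ℕ := ⟨ENNReal.ofReal (μ / N) • Measure.dirac N
    + ENNReal.ofReal (1 - μ / N) • Measure.dirac 0, ⟨by
      simp [← ENNReal.ofReal_add hm0 (sub_nonneg.2 hm1)]⟩⟩
  refine ⟨π, rfl, ?_, ?_⟩
  · change ∫⁻ k : ℕ, (k : ℝ≥0∞) ∂(ENNReal.ofReal (μ / N) • Measure.dirac N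
      + ENNReal.ofReal (1 - μ / N) • Measure.dirac 0) = _
    rw [lintegral_add_measure, lintegral_smul_measure, lintegral_smul_measure, lintegral_dirac,
      lintegral_dirac, Nat.cast_zero, smul_zero, add_zero, smul_eq_mul, ← ENNReal.ofReal_natCast,
      ← ENNReal.ofReal_mul hm0, div_mul_cancel₀ _ hNpos.ne']
  · refine FrogModel.ae_transient (FrogModel.lintegral_weight_le hd) FrogModel.weight_root
      (ENNReal.ofReal_lt_one.2 hρ1) (ENNReal.inv_ne_zero.2 (ENNReal.natCast_ne_top _))
      (FrogModel.inv_le_stepKernel hd) π (N := N) rfl ?_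
    have hterm (n : ℕ) : ENNReal.ofReal (μ / N) *
        (min ((((d + 1 : ℕ) : ℝ≥0∞)⁻¹ ^ n)⁻¹) (N : ℝ≥0∞) *
          ENNReal.ofReal (FrogModel.spectralRate d) ^ n) =
        ENNReal.ofReal (μ / N * (min (((d : ℝ) + 1) ^ n) N * FrogModel.spectralRate d ^ n)) := by
      rw [ENNReal.ofReal_mul hm0, ENNReal.ofReal_mul (by positivity), ENNReal.ofReal_pow hρ0,
        ENNReal.ofReal_min, ENNReal.ofReal_pow (by positivity), ENNReal.ofReal_natCast,
        ← ENNReal.inv_pow, inv_inv]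
      congr
      rw [← ENNReal.ofReal_natCast]
      push_cast
      rfl
    rw [← ENNReal.tsum_mul_left]
    simp only [hterm]
    rw [← ENNReal.ofReal_tsum_of_nonneg (fun n => by positivity)]
    · exact ENNReal.ofReal_lt_one.2 (hN₁ N hN1)
    · refine Summable.of_nonneg_of_le (fun n => by positivity) (fun n => ?_)
        ((summable_geometric_of_lt_one hρ0 hρ1).mul_left (μ / N * N))
      rw [mul_assoc]
      gcongr
      exact min_le_right _ _
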